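/- Let $d \ge 1$ be an integer and equip $\mathbb C^d$ with its standard inner product $\langle \xi,\eta\rangle = \sum_{j} \xi_j\overline{\eta_j}$ and norm. Let $\mu_d$ be the Gaussian probability measure $d\mu_d(\xi) = \pi^{-d} e^{-\|\xi\|^2}\,dV_d(\xi)$ on $\mathbb C^d$, where $V_d$ is the $2d$-dimensional Lebesgue measure, and let $\mathcal B_d$ be the Segal–Bargmann space of all entire functions on $\mathbb C^d$ that belong to $L^2(\mu_d)$, with the inner product and norm of $L^2(\mu_d)$. For a holomorphic mapping $\varphi\colon \mathbb C^d \to \mathbb C^d$, let $C_\varphi$ be the composition operator in $\mathcal B_d$ with domain $\{f \in \mathcal B_d : f\circ\varphi \in \mathcal B_d\}$ and $C_\varphi f = f\circ \varphi$. Write $\boldsymbol B(\mathcal H)$ for the bounded operators defined on the whole Hilbert space $\mathcal H$ and $\mathcal R(E)$ for the range of $E$. For selfadjoint $E \in \boldsymbol B(\mathbb C^d)$, let $E^{-1}$ denote the generalized inverse $(E|_{\mathcal R(E)})^{-1}\colon \mathcal R(E) \to \mathcal R(E)$. Then $C_\varphi \in \boldsymbol B(\mathcal B_d)$ if and only if there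 exist $A \in \boldsymbol B(\mathbb C^d)$ and $b \in \mathbb C^d$ such that $\varphi(z) = Az + b$ for all $z \in \mathbb C^d$, $\|A\| \le 1$ and $b \in \mathcal R(I - AA^*)$. Moreover, if $C_\varphi \in \boldsymbol B(\mathcal B_d)$ (so that $\varphi = A + b$ with $A$ and $b$ as above, uniquely determined by $\varphi$), then $$1 \le \|C_\varphi\|^2 = \exp\big(\langle (I - AA^*)^{-1} b, b\rangle\big).$$ -/

import Mathlib

noncomputable section

namespace SegalBargmann

open MeasureTheory

/-- `ℂ^d` with its standard inner product and Euclidean norm. -/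
abbrev Cd (d : ℕ) : Type := EuclideanSpace ℂ (Fin d)

/-- The `2d`-dimensional Lebesgue measure `V_d` on `ℂ^d`: the `d`-fold product of the Lebesgue
measure of the plane `ℂ`. -/
def lebesgue (d : ℕ) : Measure (Cd d) :=
  (volume : Measure (Fin d → ℂ)).map (WithLp.toLp 2)

/-- The Gaussian measure `dμ_d(ξ) = π^{-d} exp(-‖ξ‖²) dV_d(ξ)` on `ℂ^d`. -/
def gaussian (d : ℕ) : Measure (Cd d) :=
  (lebesgue d).withDensity
    fun ξ => ENNReal.ofReal ((1 / Real.pi ^ d) * Real.exp (-(‖ξ‖ ^ 2)))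

instance instIsOpenPosMeasureLebesgue (d : ℕ) : (lebesgue d).IsOpenPosMeasure :=
  (PiLp.continuous_toLp 2 _).isOpenPosMeasure_map (WithLp.toLp_surjective 2)

instance instIsOpenPosMeasureGaussian (d : ℕ) : (gaussian d).IsOpenPosMeasure := by
  refine Measure.AbsolutelyContinuous.isOpenPosMeasure (μ := lebesgue d)
    (withDensity_absolutelyContinuous' (by fun_prop) (Filter.Eventually.of_forall fun ξ => ?_))
  have h : 0 < (1 / Real.pi ^ d) * Real.exp (-(‖ξ‖ ^ 2)) := by positivity
  simpa using h

/-- The vector space of entire functions on `ℂ^d` that are square integrable with respect to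
the Gaussian measure. -/
def entireL2 (d : ℕ) : Submodule ℂ (Cd d → ℂ) where
  carrier := {f | Differentiable ℂ f ∧ MemLp f 2 (gaussian d)}
  add_mem' hf hg := ⟨hf.1.add hg.1, hf.2.add hg.2⟩
  zero_mem' := ⟨differentiable_const 0, MemLp.zero⟩
  smul_mem' c _ hf := ⟨hf.1.const_smul c, hf.2.const_smul c⟩

/-- The Segal-Bargmann space `B_d` of order `d`. It is kept apart from the type of elements of
`entireL2 d`, which carries the topology of pointwise convergence in Mathlib. -/
def Space (d : ℕ) : Type := entireL2 d

namespace Space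

variable {d : ℕ}

instance : AddCommGroup (Space d) := inferInstanceAs (AddCommGroup (entireL2 d))

instance : Module ℂ (Space d) := inferInstanceAs (Module ℂ (entireL2 d))

/-- The entire function underlying an element of `B_d`. -/
def toFun (f : Space d) : Cd d → ℂ := f.1

instance : CoeFun (Space d) (fun _ => Cd d → ℂ) := ⟨toFun⟩

/-- The inclusion of `B_d` in `L²(μ_d)`. -/
def toL2 (d : ℕ) : Space d →ₗ[ℂ] Lp ℂ 2 (gaussian d) where
  toFun f := MemLp.toLp f f.2.2
  map_add' f g := MemLp.toLp_add f.2.2 g.2.2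
  map_smul' c f := MemLp.toLp_const_smul c f.2.2

theorem toL2_injective (d : ℕ) : Function.Injective (toL2 d) := by
  intro f g h
  have h' : f.toFun =ᵐ[gaussian d] g.toFun := (MemLp.toLp_eq_toLp_iff f.2.2 g.2.2).1 h
  exact Subtype.ext ((Continuous.ae_eq_iff_eq _ f.2.1.continuous g.2.1.continuous).1 h')

/-- `B_d` carries the norm of `L²(μ_d)`. -/
instance : NormedAddCommGroup (Space d) :=
  NormedAddCommGroup.induced (Space d) (Lp ℂ 2 (gaussian d)) (toL2 d) (toL2_injective d)

/-- `B_d` carries the inner product of `L²(μ_d)`. -/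
instance : InnerProductSpace ℂ (Space d) := InnerProductSpace.induced (toL2 d)

end Space

/-- The composition operator `C_φ` in `B_d` with symbol `φ`, as a possibly unbounded operator:
its domain consists of those `f ∈ B_d` for which `f ∘ φ ∈ B_d`, and `C_φ f = f ∘ φ`. -/
def compositionOperator {d : ℕ} (φ : Cd d → Cd d) : Space d →ₗ.[ℂ] Space d where
  domain :=
    { carrier := {f | f.toFun ∘ φ ∈ entireL2 d}
      add_mem' := fun hf hg => (entireL2 d).add_mem hf hg
      zero_mem' := (entireL2 d).zero_mem
      smul_mem' := fun c _ hf => (entireL2 d).smul_mem c hf }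
  toFun :=
    { toFun := fun f => ⟨f.1.toFun ∘ φ, f.2⟩
      map_add' := fun _ _ => rfl
      map_smul' := fun _ _ => rfl }

/-- `IsEverywhereBounded C T` says that the operator `C` in `E` is defined on all of `E` and
bounded, and that `T` is `C` regarded as an element of the algebra of bounded operators. -/
def IsEverywhereBounded {E : Type*} [NormedAddCommGroup E] [InnerProductSpace ℂ E]
    (C : E →ₗ.[ℂ] E) (T : E →L[ℂ] E) : Prop :=
  C = (T : E →ₗ[ℂ] E).toPMap ⊤

/-- The generalized inverse `E⁻¹ = (E|_{closure of R(E)})⁻¹` of a selfadjoint bounded operator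
`E`; for selfadjoint `E` its domain is the range `R(E)`. -/
def generalizedInverse {H : Type*} [NormedAddCommGroup H] [InnerProductSpace ℂ H]
    (E : H →L[ℂ] H) : H →ₗ.[ℂ] H :=
  ((E : H →ₗ[ℂ] H).toPMap (E : H →ₗ[ℂ] H).range.topologicalClosure).inverse

end SegalBargmann

end

/-! Lower bound: point evaluation satisfies `‖f z‖² ≤ exp(‖z‖²) ‖f‖²`, with equality at `u` for the
unit vector `normalizedKernel u`. Testing `T` on `normalizedKernel (φ w)` gives `exp(‖φ w‖² - ‖w‖²)
≤ ‖T‖²` (`exp_le_norm_sq`). Hence `φ` grows at most like `‖z‖ + K`, so it is affine with contractive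
linear part by Cauchy and Liouville, and `b` is orthogonal to `ker (1 - A A*)`. Upper bound: write
`b = c - A A* c`. Up to a scalar, `C_φ` is composition with `A` between two Weyl isometries
(`energy_comp_affine_le`). Composition with `A` is a contraction: choose `D` with `A A* + D D* = 1`,
bound `‖f (A z)‖²` by the Gaussian mean of `‖f (A z + D w)‖²` over `w`, and use that `A z + D w` is
again Gaussian. The scalar contributes `exp(‖c‖² - ‖A* c‖²)`, which the lower bound attains at `w =
A* c`, since `φ (A* c) = c`; the exponent is `⟨c, b⟩`. -/

noncomputable section

/-! ### Growth of entire maps and the range condition -/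

/-- An entire map of linear growth with constant one is affine, with contractive linear part. -/
theorem eq_fderiv_add_of_norm_le {E F : Type*} [NormedAddCommGroup E]
    [NormedSpace ℂ E] [NormedAddCommGroup F] [NormedSpace ℂ F] [CompleteSpace F]
    {φ : E → F} (hφ : Differentiable ℂ φ) {K : ℝ} (hK : ∀ z, ‖φ z‖ ≤ ‖z‖ + K) :
    ‖fderiv ℂ φ 0‖ ≤ 1 ∧ ∀ z, φ z = fderiv ℂ φ 0 z + φ 0 := by
  have hline : ∀ v : E, Differentiable ℂ fun t : ℂ => φ (t • v) := fun v => hφ.comp (by fun_prop)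
  have hbound : ∀ (v : E) (t : ℂ), ‖deriv (fun t : ℂ => φ (t • v)) t‖ ≤ ‖v‖ := by
    intro v t
    -- Cauchy's estimate on the circle of radius `R` about `t`; as `R → ∞` only `‖v‖` survives.
    have hR : ∀ R : ℝ, 0 < R →
        ‖deriv (fun t : ℂ => φ (t • v)) t‖ ≤ ‖v‖ + (‖t‖ * ‖v‖ + K) / R := by
      intro R hR
      have := Complex.norm_deriv_le_of_forall_mem_sphere_norm_le (c := t) (R := R)
        (C := (‖t‖ + R) * ‖v‖ + K) hR (hline v).diffContOnCl (by
          intro z hz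
          refine (hK _).trans ?_
          rw [norm_smul]
          have : ‖z‖ ≤ ‖t‖ + R := by
            have h1 : ‖z - t‖ = R := by simpa [dist_eq_norm] using hz
            calc ‖z‖ = ‖t + (z - t)‖ := by congr 1; ring
              _ ≤ ‖t‖ + ‖z - t‖ := norm_add_le _ _
              _ = ‖t‖ + R := by rw [h1]
          gcongr)
      refine this.trans (le_of_eq ?_)
      field_simp
      ring
    have hlim : Filter.Tendsto (fun R : ℝ => ‖v‖ + (‖t‖ * ‖v‖ + K) / R) Filter.atTop
        (nhds (‖v‖ + 0)) :=
      tendsto_const_nhds.add (tendsto_const_nhds.div_atTop Filter.tendsto_id)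
    rw [add_zero] at hlim
    exact ge_of_tendsto hlim ((Filter.eventually_gt_atTop 0).mono hR)
  have hd0 : ∀ v, deriv (fun t : ℂ => φ (t • v)) 0 = fderiv ℂ φ 0 v := by
    intro v
    have h1 : HasFDerivAt φ (fderiv ℂ φ 0) ((0 : ℂ) • v) := by
      rw [zero_smul]; exact (hφ 0).hasFDerivAt
    have h2 : HasDerivAt (fun t : ℂ => t • v) ((1 : ℂ) • v) 0 :=
      (hasDerivAt_id (0 : ℂ)).smul_const v
    have h3 := (h1.comp_hasDerivAt (0 : ℂ) h2).deriv
    rw [one_smul] at h3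
    exact h3
  refine ⟨ContinuousLinearMap.opNorm_le_bound _ zero_le_one fun v => ?_, fun v => ?_⟩
  · rw [← hd0, one_mul]; exact hbound v 0
  · have hconst : ∀ t, deriv (fun t : ℂ => φ (t • v)) t = fderiv ℂ φ 0 v := by
      intro t
      rw [← hd0]
      refine Differentiable.apply_eq_apply_of_bounded ?_ ?_ t 0
      · exact differentiableOn_univ.1 ((hline v).differentiableOn.deriv isOpen_univ)
      · refine isBounded_iff_forall_norm_le.2 ⟨‖v‖, ?_⟩
        rintro _ ⟨t, rfl⟩
        exact hbound v t
    have hz : ∀ t, HasDerivAt (fun t : ℂ => φ (t • v) - t • fderiv ℂ φ 0 v) 0 t := by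
      intro t
      have h1 := (hline v t).hasDerivAt
      rw [hconst t] at h1
      have h2 := h1.sub ((hasDerivAt_id t).smul_const (fderiv ℂ φ 0 v))
      rw [one_smul, sub_self] at h2
      exact h2
    have := is_const_of_deriv_eq_zero (fun t => (hz t).differentiableAt)
      (fun t => (hz t).deriv) 1 0
    simp only [one_smul, zero_smul, sub_zero] at this
    rw [← this]; abel

/-- If `‖A z + b‖² - ‖z‖²` is bounded above, then `b` lies in the range of `1 - A A*`. -/
theorem ContinuousLinearMap.mem_range_one_sub_mul_adjoint {E : Type*} [NormedAddCommGroup E]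
    [InnerProductSpace ℂ E] [FiniteDimensional ℂ E] [CompleteSpace E] (A : E →L[ℂ] E) (b : E)
    {K : ℝ} (h : ∀ z, ‖A z + b‖ ^ 2 ≤ ‖z‖ ^ 2 + K) :
    b ∈ (1 - A * ContinuousLinearMap.adjoint A).range := by
  set S := 1 - A * ContinuousLinearMap.adjoint A with hS
  have hsa : S.adjoint = S := by
    rw [hS, ← ContinuousLinearMap.star_eq_adjoint, ← ContinuousLinearMap.star_eq_adjoint]
    simp
  have hmem : b ∈ (S.kerᗮ : Submodule ℂ E) := by
    rw [Submodule.mem_orthogonal]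
    intro v hv
    have hv' : A (A.adjoint v) = v := by
      have : S v = 0 := hv
      rw [hS] at this
      exact (sub_eq_zero.1 this).symm
    have hn : ‖A.adjoint v‖ ^ 2 = ‖v‖ ^ 2 := by
      have h1 := ContinuousLinearMap.adjoint_inner_left A (A.adjoint v) v
      rw [hv', inner_self_eq_norm_sq_to_K, inner_self_eq_norm_sq_to_K] at h1
      exact_mod_cast h1
    -- On `z = t A* v` with `A A* v = v` the quadratic terms cancel, leaving a real-affine function
    -- of `t` bounded above, so its slope must vanish.
    have hre : ∀ t : ℂ, 2 * (t * inner ℂ b v).re + ‖b‖ ^ 2 ≤ K := by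
      intro t
      have h1 := h (t • A.adjoint v)
      rw [map_smul, hv', norm_add_sq (𝕜 := ℂ), norm_smul, norm_smul, mul_pow, mul_pow, hn,
        inner_re_symm, inner_smul_right] at h1
      simp only [RCLike.re_to_complex] at h1
      linarith
    by_contra hne
    have hne' : inner ℂ b v ≠ 0 := fun h0 => hne (inner_eq_zero_symm.1 h0)
    have h1 := hre (((K + 1) / 2 : ℝ) / inner ℂ b v)
    rw [div_mul_cancel₀ _ hne', Complex.ofReal_re] at h1
    nlinarith [sq_nonneg ‖b‖]
  have h2 := ContinuousLinearMap.orthogonal_range S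
  rw [hsa] at h2
  rw [← h2, Submodule.orthogonal_orthogonal] at hmem
  exact hmem

namespace SegalBargmann

open MeasureTheory ComplexConjugate

variable {d : ℕ}

/-! ### The Gaussian measure and its characteristic function -/

theorem real_inner_eq_re (x y : Cd d) : inner ℝ x y = (inner ℂ x y).re := by
  simp [PiLp.inner_apply, Complex.re_sum]

instance instIsAddHaarMeasureLebesgue (d : ℕ) : (lebesgue d).IsAddHaarMeasure := by
  have h := (PiLp.continuousLinearEquiv 2 ℂ (fun _ : Fin d => ℂ)).symm.isAddHaarMeasure_map
    (volume : Measure (Fin d → ℂ))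
  exact h

theorem integral_lebesgue (f : Cd d → ℂ) :
    ∫ x, f x ∂lebesgue d = ∫ x : Fin d → ℂ, f (WithLp.toLp 2 x) :=
  (MeasurableEquiv.toLp 2 (Fin d → ℂ)).measurableEmbedding.integral_map f

/-- The density of the Gaussian measure with respect to Lebesgue measure. -/
def density (d : ℕ) (x : Cd d) : ℝ := (1 / Real.pi ^ d) * Real.exp (-(‖x‖ ^ 2))

theorem density_nonneg (x : Cd d) : 0 ≤ density d x := by
  unfold density; positivity

@[fun_prop]
theorem continuous_density : Continuous (density d) := by
  unfold density; fun_prop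

theorem gaussian_eq : gaussian d = (lebesgue d).withDensity fun x => ENNReal.ofReal (density d x) :=
  rfl

theorem integral_gaussian (f : Cd d → ℂ) :
    ∫ x, f x ∂gaussian d = ∫ x, (density d x : ℂ) * f x ∂lebesgue d := by
  rw [gaussian_eq, integral_withDensity_eq_integral_toReal_smul (by fun_prop) (by simp)]
  refine integral_congr_ae (Filter.Eventually.of_forall fun x => ?_)
  simp [ENNReal.toReal_ofReal (density_nonneg x)]

theorem lintegral_gaussian {f : Cd d → ENNReal} (hf : Measurable f) :
    ∫⁻ x, f x ∂gaussian d = ∫⁻ x, ENNReal.ofReal (density d x) * f x ∂lebesgue d := by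
  rw [gaussian_eq, lintegral_withDensity_eq_lintegral_mul _ (by fun_prop) hf]
  rfl

/-- Density and character both factor over coordinates, leaving Gaussian Fourier integrals on `ℂ`.
The case `t = 0` gives total mass one. -/
theorem charFun_gaussian (t : Cd d) :
    charFun (gaussian d) t = Complex.exp (-(‖t‖ ^ 2 / 4 : ℝ)) := by
  have hpi : (Real.pi : ℂ) ≠ 0 := by exact_mod_cast Real.pi_ne_zero
  have key : ∀ x : Fin d → ℂ, (density d (WithLp.toLp 2 x) : ℂ) *
      Complex.exp (inner ℝ (WithLp.toLp 2 x) t * Complex.I) =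
      ∏ i, ((1 / Real.pi : ℂ) *
        Complex.exp (-1 * ‖x i‖ ^ 2 + Complex.I * (inner ℝ (t i) (x i) : ℝ))) := by
    intro x
    rw [Finset.prod_mul_distrib, ← Complex.exp_sum, density, EuclideanSpace.norm_sq_eq,
      PiLp.inner_apply]
    simp only [Finset.prod_const, Finset.card_univ, Fintype.card_fin, Finset.sum_add_distrib,
      ← Finset.mul_sum]
    push_cast
    rw [mul_assoc, ← Complex.exp_add, one_div_pow]
    congr 2
    simp only [neg_mul, one_mul, mul_comm Complex.I]
    congr 3
    ext i
    rw [real_inner_comm]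
  rw [charFun_apply, integral_gaussian, integral_lebesgue]
  simp_rw [key]
  rw [integral_fintype_prod_volume_eq_prod (fun (i : Fin d) (z : ℂ) => ((1 / Real.pi : ℂ) *
        Complex.exp (-1 * ‖z‖ ^ 2 + Complex.I * (inner ℝ (t i) z : ℝ))))]
  have h1 : ∀ i, ∫ z : ℂ, ((1 / Real.pi : ℂ) *
        Complex.exp (-1 * ‖z‖ ^ 2 + Complex.I * (inner ℝ (t i) z : ℝ))) =
        Complex.exp (-(‖t i‖ ^ 2 / 4 : ℝ)) := by
    intro i
    rw [integral_const_mul, GaussianFourier.integral_cexp_neg_mul_sq_norm_add (by simp)]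
    simp only [Complex.finrank_real_complex, Complex.I_sq]
    norm_num
    congr 1; ring
  simp_rw [h1]
  rw [← Complex.exp_sum, EuclideanSpace.norm_sq_eq]
  congr 1
  push_cast
  rw [Finset.sum_neg_distrib, Finset.sum_div]

theorem integral_one_gaussian : ∫ _, (1 : ℂ) ∂gaussian d = 1 := by
  have h := charFun_gaussian (0 : Cd d)
  simpa [charFun_apply] using h

instance instIsProbabilityMeasureGaussian (d : ℕ) : IsProbabilityMeasure (gaussian d) := by
  have h := integral_one_gaussian (d := d)
  rw [integral_const] at h
  have h2 : (gaussian d).real Set.univ = 1 := by simpa using h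
  refine ⟨?_⟩
  rw [Measure.real] at h2
  exact (ENNReal.toReal_eq_one_iff _).1 h2

/-- If `‖A* t‖² + ‖D* t‖² = ‖t‖²`, then `A z + D w` has the Gaussian law whenever `z` and `w`
are independent with the Gaussian law. -/
theorem map_gaussian_prod (A D : Cd d →L[ℂ] Cd d)
    (h : ∀ t, ‖A.adjoint t‖ ^ 2 + ‖D.adjoint t‖ ^ 2 = ‖t‖ ^ 2) :
    ((gaussian d).prod (gaussian d)).map (fun p => A p.1 + D p.2) = gaussian d := by
  have hm : Measurable fun p : Cd d × Cd d => A p.1 + D p.2 := by fun_prop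
  have : IsProbabilityMeasure
      (((gaussian d).prod (gaussian d)).map (fun p => A p.1 + D p.2)) :=
    Measure.isProbabilityMeasure_map hm.aemeasurable
  refine Measure.ext_of_charFun ?_
  ext t
  rw [charFun_apply, integral_map hm.aemeasurable (by fun_prop)]
  have hadj : ∀ (B : Cd d →L[ℂ] Cd d) (x : Cd d), inner ℝ (B x) t = inner ℝ x (B.adjoint t) := by
    intro B x
    rw [real_inner_eq_re, real_inner_eq_re, ContinuousLinearMap.adjoint_inner_right]
  simp_rw [inner_add_left, hadj, Complex.ofReal_add, add_mul, Complex.exp_add]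
  rw [integral_prod_mul (fun x => Complex.exp ((inner ℝ x (A.adjoint t) : ℝ) * Complex.I))
    (fun x => Complex.exp ((inner ℝ x (D.adjoint t) : ℝ) * Complex.I)), ← charFun_apply,
    ← charFun_apply, charFun_gaussian, charFun_gaussian, charFun_gaussian, ← Complex.exp_add,
    ← h t]
  congr 1
  push_cast
  ring

theorem lintegral_gaussian_smul {f : Cd d → ENNReal} (hf : Measurable f) {c : ℂ} (hc : ‖c‖ = 1) :
    ∫⁻ x, f (c • x) ∂gaussian d = ∫⁻ x, f x ∂gaussian d := by
  -- Rotation invariance is the case `D = 0` with `A` unitary.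
  have h := map_gaussian_prod (d := d) (c • 1) 0 (by simp [hc, norm_smul, ← ContinuousLinearMap.star_eq_adjoint])
  conv_rhs => rw [← h]
  rw [lintegral_map hf (by fun_prop), lintegral_prod _ (by fun_prop)]
  simp

/-! ### Mean value inequality and linear contractions -/

/-- The mean value inequality for entire functions and the Gaussian measure. -/
theorem enorm_apply_zero_le_lintegral {h : Cd d → ℂ} (hh : Differentiable ℂ h) :
    ‖h 0‖ₑ ≤ ∫⁻ x, ‖h x‖ₑ ∂gaussian d := by
  have hcont := hh.continuous
  have hpi : ENNReal.ofReal (2 * Real.pi) ≠ 0 := by simp [Real.pi_pos]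
  have hc1 : ∀ θ : ℝ, ‖circleMap 0 1 θ‖ = 1 := fun θ => by simp [circleMap]
  -- Mean value property on each complex line through the origin; Tonelli and rotation invariance
  -- then remove the average over `θ`.
  have hmean : ∀ x : Cd d, ENNReal.ofReal (2 * Real.pi) * ‖h 0‖ₑ ≤
      ∫⁻ θ in Set.Ioc 0 (2 * Real.pi), ‖h (circleMap 0 1 θ • x)‖ₑ := by
    intro x
    have hg : Differentiable ℂ fun c : ℂ => h (c • x) := by fun_prop
    have h1 := (hg.diffContOnCl (s := Metric.ball 0 |1|)).circleAverage
    rw [Real.circleAverage_def, intervalIntegral.integral_of_le (by positivity)] at h1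
    simp only [zero_smul] at h1
    rw [← h1, enorm_smul, ← mul_assoc]
    have : ENNReal.ofReal (2 * Real.pi) * ‖(2 * Real.pi)⁻¹‖ₑ = 1 := by
      rw [Real.enorm_of_nonneg (by positivity), ← ENNReal.ofReal_mul (by positivity),
        mul_inv_cancel₀ (by positivity), ENNReal.ofReal_one]
    rw [this, one_mul]
    exact enorm_integral_le_lintegral_enorm _
  have h2 : ENNReal.ofReal (2 * Real.pi) * ‖h 0‖ₑ ≤
      ENNReal.ofReal (2 * Real.pi) * ∫⁻ x, ‖h x‖ₑ ∂gaussian d := by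
    calc _ = ∫⁻ _, ENNReal.ofReal (2 * Real.pi) * ‖h 0‖ₑ ∂gaussian d := by simp
      _ ≤ ∫⁻ x, (∫⁻ θ in Set.Ioc 0 (2 * Real.pi), ‖h (circleMap 0 1 θ • x)‖ₑ) ∂gaussian d :=
        lintegral_mono hmean
      _ = ∫⁻ θ in Set.Ioc 0 (2 * Real.pi), (∫⁻ x, ‖h (circleMap 0 1 θ • x)‖ₑ ∂gaussian d) := by
        rw [lintegral_lintegral_swap]
        have hc : Continuous fun p : Cd d × ℝ => h (circleMap 0 1 p.2 • p.1) :=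
          hcont.comp (((continuous_circleMap 0 1).comp continuous_snd).smul continuous_fst)
        exact hc.enorm.measurable.aemeasurable
      _ = _ := by
        simp_rw [fun θ => lintegral_gaussian_smul (f := fun x => ‖h x‖ₑ) (by fun_prop) (hc1 θ)]
        rw [setLIntegral_const, Real.volume_Ioc, sub_zero, mul_comm]
  exact (ENNReal.mul_le_mul_iff_right hpi ENNReal.ofReal_ne_top).1 h2

/-- The square of the `L²(μ_d)` norm, as an extended nonnegative real. -/
def energy (f : Cd d → ℂ) : ENNReal := ∫⁻ x, ‖f x‖ₑ ^ 2 ∂gaussian d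

theorem enorm_apply_zero_sq_le_energy {f : Cd d → ℂ} (hf : Differentiable ℂ f) :
    ‖f 0‖ₑ ^ 2 ≤ energy f := by
  -- The square of `f` is entire too, so the `L¹` inequality yields the `L²` one.
  have h := enorm_apply_zero_le_lintegral (h := fun x => f x ^ 2) (by fun_prop)
  simpa [energy, enorm_pow] using h

/-- Contractivity makes `1 - A A*` nonnegative, hence of the form `B* B`; take `D = B*`. -/
theorem exists_adjoint_norm_sq_add {A : Cd d →L[ℂ] Cd d} (hA : ‖A‖ ≤ 1) :
    ∃ D : Cd d →L[ℂ] Cd d, ∀ t, ‖A.adjoint t‖ ^ 2 + ‖D.adjoint t‖ ^ 2 = ‖t‖ ^ 2 := by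
  have hpos : 0 ≤ 1 - A * star A := by
    have h1 := CStarAlgebra.mul_star_le_algebraMap_norm_sq (a := A)
    have h2 : algebraMap ℝ (Cd d →L[ℂ] Cd d) (‖A‖ ^ 2) ≤ algebraMap ℝ (Cd d →L[ℂ] Cd d) 1 := by
      apply algebraMap_mono
      exact pow_le_one₀ (norm_nonneg _) hA
    rw [map_one] at h2
    exact sub_nonneg.2 (h1.trans h2)
  obtain ⟨B, hB⟩ := CStarAlgebra.nonneg_iff_eq_star_mul_self.1 hpos
  refine ⟨star B, fun t => ?_⟩
  rw [ContinuousLinearMap.star_eq_adjoint] at hB ⊢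
  rw [ContinuousLinearMap.star_eq_adjoint] at hB
  rw [ContinuousLinearMap.adjoint_adjoint]
  have h1 := congrArg (fun L : Cd d →L[ℂ] Cd d => (inner ℂ (L t) t).re) hB
  simp only [sub_apply, one_apply_eq_self,
    mul_apply_eq_comp, inner_sub_left, Complex.sub_re] at h1
  rw [ContinuousLinearMap.adjoint_inner_left, ← ContinuousLinearMap.adjoint_inner_right] at h1
  have hs : ∀ v : Cd d, (inner ℂ v v).re = ‖v‖ ^ 2 := fun v => inner_self_eq_norm_sq (𝕜 := ℂ) v
  rw [hs, hs, hs] at h1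
  linarith

/-- Composition with a linear contraction is a contraction. -/
theorem energy_comp_linear_le {A : Cd d →L[ℂ] Cd d} (hA : ‖A‖ ≤ 1) {f : Cd d → ℂ}
    (hf : Differentiable ℂ f) : energy (fun z => f (A z)) ≤ energy f := by
  obtain ⟨D, hD⟩ := exists_adjoint_norm_sq_add hA
  have hcont := hf.continuous
  calc energy (fun z => f (A z)) ≤ ∫⁻ z, ∫⁻ w, ‖f (A z + D w)‖ₑ ^ 2 ∂gaussian d ∂gaussian d := by
        refine lintegral_mono fun z => ?_
        simpa [energy] using enorm_apply_zero_sq_le_energy (f := fun w => f (A z + D w))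
          (by fun_prop)
    _ = energy f := by
        rw [energy]
        conv_rhs => rw [← map_gaussian_prod A D hD]
        rw [lintegral_map (by fun_prop) (by fun_prop), lintegral_prod _ (by fun_prop)]

/-! ### Weyl translations and affine symbols -/

/-- The Weyl operators: translations, weighted so as to preserve the norm of `L²(μ_d)`. -/
def weyl (c : Cd d) (f : Cd d → ℂ) (z : Cd d) : ℂ :=
  Complex.exp (-(inner ℂ c z) - (‖c‖ ^ 2 / 2 : ℝ)) * f (z + c)

theorem differentiable_weyl (c : Cd d) {f : Cd d → ℂ} (hf : Differentiable ℂ f) :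
    Differentiable ℂ (weyl c f) := by
  have h : Differentiable ℂ fun z : Cd d => inner ℂ c z := (innerSL ℂ c).differentiable
  unfold weyl
  fun_prop

theorem density_mul_enorm_weyl (c : Cd d) (f : Cd d → ℂ) (z : Cd d) :
    ENNReal.ofReal (density d z) * ‖weyl c f z‖ₑ ^ 2 =
      ENNReal.ofReal (density d (z + c)) * ‖f (z + c)‖ₑ ^ 2 := by
  rw [weyl, enorm_mul, mul_pow, ← mul_assoc]
  congr 1
  rw [← ofReal_norm, Complex.norm_exp, ← ENNReal.ofReal_pow (by positivity),
    ← ENNReal.ofReal_mul (density_nonneg z), density, density, mul_assoc, ← Real.exp_nat_mul,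
    ← Real.exp_add, norm_add_sq (𝕜 := ℂ), inner_re_symm]
  congr 3
  simp [-Complex.ofReal_pow]
  ring

theorem energy_weyl (c : Cd d) {f : Cd d → ℂ} (hf : Differentiable ℂ f) :
    energy (weyl c f) = energy f := by
  have hcont := hf.continuous
  have hw := (differentiable_weyl c hf).continuous
  rw [energy, energy, lintegral_gaussian (by fun_prop), lintegral_gaussian (by fun_prop)]
  simp_rw [density_mul_enorm_weyl]
  exact lintegral_add_right_eq_self
    (fun z => ENNReal.ofReal (density d z) * ‖f z‖ₑ ^ 2) c

theorem energy_const_mul (a : ℂ) {f : Cd d → ℂ} (hf : Continuous f) :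
    energy (fun z => a * f z) = ‖a‖ₑ ^ 2 * energy f := by
  simp_rw [energy, enorm_mul, mul_pow]
  exact lintegral_const_mul _ (by fun_prop)

theorem energy_one : energy (fun _ : Cd d => (1 : ℂ)) = 1 := by
  simp [energy]

/-- The point evaluation estimate. -/
theorem enorm_apply_sq_le {f : Cd d → ℂ} (hf : Differentiable ℂ f) (z : Cd d) :
    ‖f z‖ₑ ^ 2 ≤ ENNReal.ofReal (Real.exp (‖z‖ ^ 2)) * energy f := by
  have h := enorm_apply_zero_sq_le_energy (differentiable_weyl z hf)
  rw [energy_weyl z hf, weyl, enorm_mul, mul_pow, zero_add] at h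
  have h2 : ENNReal.ofReal (Real.exp (‖z‖ ^ 2)) *
      ‖Complex.exp (-(inner ℂ z (0 : Cd d)) - (‖z‖ ^ 2 / 2 : ℝ))‖ₑ ^ 2 = 1 := by
    rw [← ofReal_norm, Complex.norm_exp, ← ENNReal.ofReal_pow (by positivity),
      ← ENNReal.ofReal_mul (by positivity), ← Real.exp_nat_mul, ← Real.exp_add]
    simp [-Complex.ofReal_pow]
    ring_nf
  calc ‖f z‖ₑ ^ 2 = ENNReal.ofReal (Real.exp (‖z‖ ^ 2)) *
      (‖Complex.exp (-(inner ℂ z (0 : Cd d)) - (‖z‖ ^ 2 / 2 : ℝ))‖ₑ ^ 2 * ‖f z‖ₑ ^ 2) := by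
        rw [← mul_assoc, h2, one_mul]
    _ ≤ _ := by gcongr

/-- The bound for composition with an affine map, by Weyl translations. -/
theorem energy_comp_affine_le {A : Cd d →L[ℂ] Cd d} (hA : ‖A‖ ≤ 1) (c : Cd d) {f : Cd d → ℂ}
    (hf : Differentiable ℂ f) :
    energy (fun z => f (A z + (c - A (A.adjoint c)))) ≤
      ENNReal.ofReal (Real.exp (‖c‖ ^ 2 - ‖A.adjoint c‖ ^ 2)) * energy f := by
  set a : ℝ := (‖c‖ ^ 2 - ‖A.adjoint c‖ ^ 2) / 2 with ha
  have hg : Differentiable ℂ fun z => weyl c f (A z) :=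
    (differentiable_weyl c hf).comp A.differentiable
  -- The second translation is by `-A* c` because `⟨c, A z⟩ = ⟨A* c, z⟩` makes the exponents linear
  -- in `z` cancel; only the constant `-a` remains.
  have key : (fun z => f (A z + (c - A (A.adjoint c)))) =
      fun z => Complex.exp a * weyl (-A.adjoint c) (fun z => weyl c f (A z)) z := by
    ext z
    have h2 : (inner ℂ c (A (A.adjoint c))) = ((‖A.adjoint c‖ ^ 2 : ℝ) : ℂ) := by
      rw [← ContinuousLinearMap.adjoint_inner_left, inner_self_eq_norm_sq_to_K]
      simp
    have h1 : A (z + -A.adjoint c) + c = A z + (c - A (A.adjoint c)) := by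
      rw [map_add, map_neg]; abel
    simp only [weyl]
    rw [h1, ← mul_assoc, ← mul_assoc, ← Complex.exp_add, ← Complex.exp_add, map_add, map_neg,
      inner_neg_left, inner_add_right, inner_neg_right, h2,
      ContinuousLinearMap.adjoint_inner_left, norm_neg]
    refine (one_mul _).symm.trans ?_
    congr 1
    rw [← Complex.exp_zero]
    congr 1
    rw [ha]
    push_cast
    ring
  rw [key, energy_const_mul _ (differentiable_weyl _ hg).continuous, energy_weyl _ hg]
  have h3 : ‖Complex.exp a‖ₑ ^ 2 = ENNReal.ofReal (Real.exp (‖c‖ ^ 2 - ‖A.adjoint c‖ ^ 2)) := by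
    rw [← ofReal_norm, Complex.norm_exp, ← ENNReal.ofReal_pow (by positivity),
      ← Real.exp_nat_mul, ha]
    simp [-Complex.ofReal_pow]
    ring_nf
  rw [h3]
  gcongr
  exact (energy_comp_linear_le hA (differentiable_weyl c hf)).trans (energy_weyl c hf).le

/-! ### Energy versus norm, and normalized kernels -/

theorem eLpNorm_sq_eq_energy (f : Cd d → ℂ) : eLpNorm f 2 (gaussian d) ^ 2 = energy f := by
  rw [energy]
  have h := eLpNorm_nnreal_pow_eq_lintegral (μ := gaussian d) (f := f) (p := 2) two_ne_zero
  simpa only [NNReal.coe_ofNat, ENNReal.coe_ofNat, ENNReal.rpow_ofNat] using h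

theorem memLp_iff_energy_ne_top {f : Cd d → ℂ} (hf : Continuous f) :
    MemLp f 2 (gaussian d) ↔ energy f ≠ ⊤ := by
  rw [← eLpNorm_sq_eq_energy, MemLp, and_iff_right hf.aestronglyMeasurable, lt_top_iff_ne_top]
  simp

theorem mem_entireL2_iff {f : Cd d → ℂ} :
    f ∈ entireL2 d ↔ Differentiable ℂ f ∧ energy f ≠ ⊤ :=
  and_congr_right fun h => memLp_iff_energy_ne_top h.continuous

namespace Space

theorem differentiable (f : Space d) : Differentiable ℂ f.toFun := f.2.1

theorem ofReal_norm_sq (f : Space d) : ENNReal.ofReal (‖f‖ ^ 2) = energy f.toFun := by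
  have h : ‖f‖ = (eLpNorm f.toFun 2 (gaussian d)).toReal := Lp.norm_toLp f.1 f.2.2
  have hfin : eLpNorm f.toFun 2 (gaussian d) ≠ ⊤ := f.2.2.2.ne
  rw [h, ENNReal.ofReal_pow (by positivity), ENNReal.ofReal_toReal hfin,
    eLpNorm_sq_eq_energy]

/-- An entire function of finite energy, as an element of the Segal-Bargmann space. -/
def mk (f : Cd d → ℂ) (hf : Differentiable ℂ f) (h : energy f ≠ ⊤) : Space d :=
  ⟨f, mem_entireL2_iff.2 ⟨hf, h⟩⟩

theorem toFun_mk (f : Cd d → ℂ) (hf : Differentiable ℂ f) (h : energy f ≠ ⊤) :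
    (mk f hf h).toFun = f := rfl

/-- The normalized exponential function `z ↦ exp (⟨z, u⟩ - ‖u‖² / 2)`. -/
def normalizedKernel (u : Cd d) : Space d :=
  mk (weyl (-u) fun _ => 1) (differentiable_weyl _ (differentiable_const 1))
    (by rw [energy_weyl _ (differentiable_const 1), energy_one]; simp)

theorem norm_normalizedKernel (u : Cd d) : ‖normalizedKernel u‖ = 1 := by
  have h := ofReal_norm_sq (normalizedKernel u)
  rw [normalizedKernel, toFun_mk, energy_weyl _ (differentiable_const 1), energy_one,
    ENNReal.ofReal_eq_one] at h
  exact (pow_eq_one_iff_of_nonneg (norm_nonneg _) two_ne_zero).1 h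

theorem norm_normalizedKernel_apply_self_sq (u : Cd d) :
    ‖(normalizedKernel u).toFun u‖ ^ 2 = Real.exp (‖u‖ ^ 2) := by
  rw [normalizedKernel, toFun_mk, weyl, mul_one, Complex.norm_exp, ← Real.exp_nat_mul]
  congr 1
  have : inner ℂ u u = ((‖u‖ ^ 2 : ℝ) : ℂ) := by
    rw [inner_self_eq_norm_sq_to_K]; simp
  rw [inner_neg_left, this, norm_neg, neg_neg, ← Complex.ofReal_sub, Complex.ofReal_re]
  push_cast
  ring

theorem norm_apply_sq_le (f : Space d) (z : Cd d) :
    ‖f.toFun z‖ ^ 2 ≤ Real.exp (‖z‖ ^ 2) * ‖f‖ ^ 2 := by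
  have h := enorm_apply_sq_le f.differentiable z
  rw [← ofReal_norm_sq, ← ENNReal.ofReal_mul (by positivity), ← ofReal_norm,
    ← ENNReal.ofReal_pow (by positivity)] at h
  exact (ENNReal.ofReal_le_ofReal_iff (by positivity)).1 h

end Space

/-! ### Norm bounds for composition operators -/

theorem isEverywhereBounded_compositionOperator_iff {φ : Cd d → Cd d}
    {T : Space d →L[ℂ] Space d} :
    IsEverywhereBounded (compositionOperator φ) T ↔ ∀ f, (T f).toFun = f.toFun ∘ φ := by
  constructor
  · intro h f
    have hf : f ∈ (compositionOperator φ).domain := by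
      rw [show compositionOperator φ = _ from h]; trivial
    have h0 : compositionOperator φ = (T : Space d →ₗ[ℂ] Space d).toPMap ⊤ := h
    have h1 : compositionOperator φ ⟨f, hf⟩ = T f :=
      (LinearPMap.ext_iff.1 h0).2 (x := f) (hf := hf) (hg := trivial)
    exact (congrArg Space.toFun h1).symm
  · intro h
    refine LinearPMap.ext ?_ ?_
    · refine eq_top_iff.2 fun f _ => ?_
      change f.toFun ∘ φ ∈ entireL2 d
      rw [← h f]
      exact (T f).2
    · intro f hf hf'
      exact Subtype.ext (h f).symm

/-- The lower bound for the norm of a composition operator. -/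
theorem exp_le_norm_sq {φ : Cd d → Cd d} {T : Space d →L[ℂ] Space d}
    (hT : ∀ f, (T f).toFun = f.toFun ∘ φ) (w : Cd d) :
    Real.exp (‖φ w‖ ^ 2 - ‖w‖ ^ 2) ≤ ‖T‖ ^ 2 := by
  have h1 := Space.norm_apply_sq_le (T (Space.normalizedKernel (φ w))) w
  rw [hT, Function.comp_apply, Space.norm_normalizedKernel_apply_self_sq] at h1
  have h2 := T.le_opNorm (Space.normalizedKernel (φ w))
  rw [Space.norm_normalizedKernel, mul_one] at h2
  rw [Real.exp_sub, div_le_iff₀ (Real.exp_pos _), mul_comm]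
  exact h1.trans (by gcongr)

theorem norm_sq_le_add_log {φ : Cd d → Cd d} {T : Space d →L[ℂ] Space d}
    (hT : ∀ f, (T f).toFun = f.toFun ∘ φ) (w : Cd d) :
    ‖φ w‖ ^ 2 ≤ ‖w‖ ^ 2 + Real.log (‖T‖ ^ 2) := by
  have h := exp_le_norm_sq hT w
  have := (Real.le_log_iff_exp_le ((Real.exp_pos _).trans_le h)).2 h
  linarith

theorem one_le_norm_sq {φ : Cd d → Cd d} {T : Space d →L[ℂ] Space d}
    (hT : ∀ f, (T f).toFun = f.toFun ∘ φ) : 1 ≤ ‖T‖ ^ 2 := by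
  refine le_trans ?_ (exp_le_norm_sq hT 0)
  simp

/-- Symbols of bounded composition operators are affine, with contractive linear part. -/
theorem norm_fderiv_le_one_and_eq {φ : Cd d → Cd d} (hφ : Differentiable ℂ φ)
    {T : Space d →L[ℂ] Space d} (hT : ∀ f, (T f).toFun = f.toFun ∘ φ) :
    ‖fderiv ℂ φ 0‖ ≤ 1 ∧ ∀ z, φ z = fderiv ℂ φ 0 z + φ 0 := by
  have hlog : 0 ≤ Real.log (‖T‖ ^ 2) := Real.log_nonneg (one_le_norm_sq hT)
  -- `‖z‖² + K² ≤ (‖z‖ + K)²` turns the quadratic bound into linear growth.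
  refine eq_fderiv_add_of_norm_le hφ (K := Real.sqrt (Real.log (‖T‖ ^ 2))) fun z => ?_
  refine abs_le_of_sq_le_sq' ?_ (by positivity) |>.2
  have := norm_sq_le_add_log hT z
  have h2 := Real.sq_sqrt hlog
  have h3 : 0 ≤ ‖z‖ * Real.sqrt (Real.log (‖T‖ ^ 2)) := by positivity
  nlinarith

theorem sub_apply_adjoint_eq {A : Cd d →L[ℂ] Cd d} {b c : Cd d}
    (hc : (1 - A * ContinuousLinearMap.adjoint A) c = b) : c - A (A.adjoint c) = b := hc

theorem inner_eq_of_one_sub_mul_adjoint_eq {A : Cd d →L[ℂ] Cd d} {b c : Cd d}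
    (hc : (1 - A * ContinuousLinearMap.adjoint A) c = b) :
    inner ℂ b c = ((‖c‖ ^ 2 - ‖A.adjoint c‖ ^ 2 : ℝ) : ℂ) := by
  rw [← sub_apply_adjoint_eq hc, inner_sub_left,
    ← ContinuousLinearMap.adjoint_inner_right, inner_self_eq_norm_sq_to_K,
    inner_self_eq_norm_sq_to_K]
  simp

theorem norm_sq_le_of_affine {A : Cd d →L[ℂ] Cd d} (hA : ‖A‖ ≤ 1) {b c : Cd d}
    (hc : (1 - A * ContinuousLinearMap.adjoint A) c = b) {f g : Space d}
    (h : g.toFun = fun z => f.toFun (A z + b)) :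
    ‖g‖ ^ 2 ≤ Real.exp (‖c‖ ^ 2 - ‖A.adjoint c‖ ^ 2) * ‖f‖ ^ 2 := by
  have h1 := energy_comp_affine_le hA c f.differentiable
  rw [sub_apply_adjoint_eq hc, ← h, ← Space.ofReal_norm_sq,
    ← Space.ofReal_norm_sq, ← ENNReal.ofReal_mul (by positivity)] at h1
  exact (ENNReal.ofReal_le_ofReal_iff (by positivity)).1 h1

theorem exists_isEverywhereBounded {φ : Cd d → Cd d} {A : Cd d →L[ℂ] Cd d} (hA : ‖A‖ ≤ 1)
    {b c : Cd d} (hφ : ∀ z, φ z = A z + b)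
    (hc : (1 - A * ContinuousLinearMap.adjoint A) c = b) :
    ∃ T : Space d →L[ℂ] Space d, ∀ f, (T f).toFun = f.toFun ∘ φ := by
  obtain rfl : φ = fun z => A z + b := funext hφ
  have hmem : ∀ f : Space d, f.toFun ∘ (fun z => A z + b) ∈ entireL2 d := by
    intro f
    have hf := f.differentiable
    refine mem_entireL2_iff.2 ⟨hf.comp (by fun_prop), ?_⟩
    have h1 := energy_comp_affine_le hA c hf
    rw [sub_apply_adjoint_eq hc, ← Space.ofReal_norm_sq,
      ← ENNReal.ofReal_mul (by positivity)] at h1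
    exact (h1.trans_lt ENNReal.ofReal_lt_top).ne
  let L : Space d →ₗ[ℂ] Space d :=
    { toFun := fun f => ⟨f.toFun ∘ (fun z => A z + b), hmem f⟩
      map_add' := fun _ _ => rfl
      map_smul' := fun _ _ => rfl }
  refine ⟨L.mkContinuous (Real.sqrt (Real.exp (‖c‖ ^ 2 - ‖A.adjoint c‖ ^ 2))) fun f => ?_,
    fun f => rfl⟩
  have h1 : ‖L f‖ ^ 2 ≤ _ := norm_sq_le_of_affine hA hc (f := f) (g := L f) rfl
  rw [← Real.sqrt_sq (norm_nonneg f), ← Real.sqrt_mul (by positivity)]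
  exact Real.le_sqrt_of_sq_le h1

/-- The norm of a bounded composition operator with affine symbol. -/
theorem norm_sq_eq_of_affine {φ : Cd d → Cd d} {A : Cd d →L[ℂ] Cd d} (hA : ‖A‖ ≤ 1)
    {b c : Cd d} (hφ : ∀ z, φ z = A z + b)
    (hc : (1 - A * ContinuousLinearMap.adjoint A) c = b)
    {T : Space d →L[ℂ] Space d} (hT : ∀ f, (T f).toFun = f.toFun ∘ φ) :
    ‖T‖ ^ 2 = Real.exp (‖c‖ ^ 2 - ‖A.adjoint c‖ ^ 2) := by
  refine le_antisymm ?_ ?_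
  · have h1 : ‖T‖ ≤ Real.sqrt (Real.exp (‖c‖ ^ 2 - ‖A.adjoint c‖ ^ 2)) := by
      refine T.opNorm_le_bound (Real.sqrt_nonneg _) fun f => ?_
      rw [← Real.sqrt_sq (norm_nonneg f), ← Real.sqrt_mul (by positivity)]
      refine Real.le_sqrt_of_sq_le (norm_sq_le_of_affine hA hc ?_)
      rw [hT]
      exact funext fun z => by simp [hφ]
    exact (Real.le_sqrt' (zero_lt_one.trans_le (by nlinarith [one_le_norm_sq hT, norm_nonneg T]))).1 h1
  -- At `w = A* c` one has `φ w = A A* c + b = c`, so the lower bound matches the upper one.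
  · have h1 := exp_le_norm_sq hT (A.adjoint c)
    rwa [hφ, ← sub_apply_adjoint_eq hc, add_sub_cancel] at h1

/-! ### The generalized inverse -/

/-- For a selfadjoint operator on a finite-dimensional space, the generalized inverse is defined
on the range and its values are preimages. -/
theorem exists_generalizedInverse_apply {H : Type*} [NormedAddCommGroup H]
    [InnerProductSpace ℂ H] [FiniteDimensional ℂ H] [CompleteSpace H] {S : H →L[ℂ] H}
    (hS : S.adjoint = S) {b : H} (hb : b ∈ S.range) :
    ∃ h : b ∈ (generalizedInverse S).domain, S (generalizedInverse S ⟨b, h⟩) = b := by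
  have hcl : (S : H →ₗ[ℂ] H).range.topologicalClosure = (S : H →ₗ[ℂ] H).range :=
    (Submodule.closed_of_finiteDimensional _).submodule_topologicalClosure_eq
  have horth : S.rangeᗮ = S.ker := by rw [S.orthogonal_range, hS]
  set P := (S : H →ₗ[ℂ] H).toPMap (S : H →ₗ[ℂ] H).range.topologicalClosure with hP
  have hker : P.toFun.ker = ⊥ := by
    refine (Submodule.eq_bot_iff _).2 fun x hx => ?_
    have hx1 : S x = 0 := hx
    have hx2 : (x : H) ∈ S.rangeᗮ := by rw [horth]; exact hx1
    have hx3 : (x : H) ∈ S.range := by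
      have : (x : H) ∈ (S : H →ₗ[ℂ] H).range.topologicalClosure := x.2
      rwa [hcl] at this
    exact Subtype.ext (inner_self_eq_zero.1 (Submodule.inner_right_of_mem_orthogonal hx3 hx2))
  obtain ⟨a, rfl⟩ := hb
  -- Dropping the component of `a` in `rangeᗮ = ker S` gives a preimage inside the range.
  obtain ⟨y, hy, z, hz, hyz⟩ := S.range.exists_add_mem_mem_orthogonal (v := a)
  have hz0 : S z = 0 := by rw [horth] at hz; exact hz
  have hya : S y = S a := by rw [hyz, map_add, hz0, add_zero]
  have hydom : y ∈ P.domain := by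
    rw [hP, LinearMap.toPMap_domain, hcl]; exact hy
  have hmem : S a ∈ (generalizedInverse S).domain := by
    rw [generalizedInverse, LinearPMap.inverse_domain]
    exact ⟨⟨y, hydom⟩, hya⟩
  refine ⟨hmem, ?_⟩
  have h1 : generalizedInverse S ⟨S a, hmem⟩ = y :=
    LinearPMap.inverse_apply_eq hker (x := ⟨y, hydom⟩) hya
  exact (congrArg S h1).trans hya

theorem adjoint_one_sub_mul_adjoint (A : Cd d →L[ℂ] Cd d) :
    (1 - A * A.adjoint).adjoint = 1 - A * A.adjoint := by
  rw [← ContinuousLinearMap.star_eq_adjoint, ← ContinuousLinearMap.star_eq_adjoint]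
  simp

end SegalBargmann

end

/-! ### The main theorem -/

theorem theorem12p4 (d : ℕ) (hd : 1 ≤ d)
    (φ : SegalBargmann.Cd d → SegalBargmann.Cd d) (hφ : Differentiable ℂ φ) :
    ((∃ T : SegalBargmann.Space d →L[ℂ] SegalBargmann.Space d,
        SegalBargmann.IsEverywhereBounded (SegalBargmann.compositionOperator φ) T) ↔
      ∃ (A : SegalBargmann.Cd d →L[ℂ] SegalBargmann.Cd d) (b : SegalBargmann.Cd d),
        (∀ z, φ z = A z + b) ∧ ‖A‖ ≤ 1 ∧
          b ∈ (1 - A * ContinuousLinearMap.adjoint A).range) ∧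
    ∀ T : SegalBargmann.Space d →L[ℂ] SegalBargmann.Space d,
      SegalBargmann.IsEverywhereBounded (SegalBargmann.compositionOperator φ) T →
        1 ≤ ‖T‖ ^ 2 ∧
        ∀ (A : SegalBargmann.Cd d →L[ℂ] SegalBargmann.Cd d) (b : SegalBargmann.Cd d),
          (∀ z, φ z = A z + b) →
            ∃ hb : b ∈ (SegalBargmann.generalizedInverse
                (1 - A * ContinuousLinearMap.adjoint A)).domain,
              ((‖T‖ ^ 2 : ℝ) : ℂ) =
                Complex.exp (inner ℂ b (SegalBargmann.generalizedInverse
                  (1 - A * ContinuousLinearMap.adjoint A) ⟨b, hb⟩)) := by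
  have hrange : ∀ T : SegalBargmann.Space d →L[ℂ] SegalBargmann.Space d,
      (∀ f, (T f).toFun = f.toFun ∘ φ) →
      ∀ (A : SegalBargmann.Cd d →L[ℂ] SegalBargmann.Cd d) (b : SegalBargmann.Cd d),
        (∀ z, φ z = A z + b) → b ∈ (1 - A * ContinuousLinearMap.adjoint A).range := by
    intro T hT A b h
    refine A.mem_range_one_sub_mul_adjoint b (K := Real.log (‖T‖ ^ 2)) fun z => ?_
    rw [← h]
    exact SegalBargmann.norm_sq_le_add_log hT z
  simp only [SegalBargmann.isEverywhereBounded_compositionOperator_iff]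
  refine ⟨⟨?_, ?_⟩, fun T hT => ⟨SegalBargmann.one_le_norm_sq hT, fun A b h => ?_⟩⟩
  · rintro ⟨T, hT⟩
    obtain ⟨h1, h2⟩ := SegalBargmann.norm_fderiv_le_one_and_eq hφ hT
    exact ⟨fderiv ℂ φ 0, φ 0, h2, h1, hrange T hT _ _ h2⟩
  · rintro ⟨A, b, h, hA, c, hc⟩
    exact SegalBargmann.exists_isEverywhereBounded hA h hc
  · obtain ⟨hb, hc⟩ := SegalBargmann.exists_generalizedInverse_apply
      (SegalBargmann.adjoint_one_sub_mul_adjoint A) (hrange T hT A b h)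
    -- Contractivity is not assumed here: any such `A` is the derivative of `φ` at `0`, already
    -- known to be contractive.
    have hA : ‖A‖ ≤ 1 := by
      have h1 : fderiv ℂ φ 0 = A := by
        rw [show φ = fun z => A z + b from funext h, fderiv_add_const]
        exact A.fderiv
      rw [← h1]
      exact (SegalBargmann.norm_fderiv_le_one_and_eq hφ hT).1
    refine ⟨hb, ?_⟩
    rw [SegalBargmann.inner_eq_of_one_sub_mul_adjoint_eq hc,
      SegalBargmann.norm_sq_eq_of_affine hA h hc hT, Complex.ofReal_exp]
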